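/- Let $(W,S)$ be a Coxeter system with $S$ finite and length function $\ell$. Let $V$ be the real vector space with basis $\{\alpha_s \mid s\in S\}$ and symmetric bilinear form $\langle\alpha_s,\alpha_t\rangle=-\cos(\pi/m(s,t))$ (equal to $-1$ if $m(s,t)=\infty$), on which $W$ acts by $sv=v-2\langle v,\alpha_s\rangle\alpha_s$, let $\Phi=\{w\alpha_s \mid w\in W,\ s\in S\}$ be the root system, and let $\Phi^+$ be the set of positive roots. For $w\in W$ put $$\Phi(w)=\{\alpha\in\Phi^+ \mid w^{-1}\alpha<0\},\qquad \Phi^R(w)=\{-w\alpha_s \mid s\in S,\ \ell(ws)<\ell(w)\},\qquad T(w)=\{v\in W \mid \ell(wv)=\ell(w)+\ell(v)\}.$$ The elements of $\Phi^R(w)$ are the final roots of $w$, and $T(w)$ is the cone type of $w$. Write $x\preceq y$ ($x$ is a prefix of $y$) if $\ell(y)=\ell(x)+\ell(x^{-1}y)$; joins $\bigvee$ are least upper bounds in the poset $(W,\preceq)$. For a cone type $T$ let $Q(T)=\{x\in W \mid T(x^{-1})=T\}$. The sets $Q(T)$ are the parts of the cone type partition $\mathscr T$ of $W$. The boundary roots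 of $T$ are the elements of $$\partial T=\{\beta\in\Phi^+ \mid \Phi(w)\cap\Phi(y)=\{\beta\}\text{ for some } w\in Q(T) \text{ and some } y\in W\}.$$ Let $\Gamma$ be the set of gates, that is, of the minimal length elements of the sets $Q(T)$, and let $\Gamma^0=\{g\in\Gamma \mid |\Phi^R(g)|=1\}$ be the set of tight gates. 1. For every $x\in\Gamma$, the set $$\partial t(x^{-1})=\{z\in W \mid z\preceq x \text{ and } \Phi^R(z)=\{\alpha\}\text{ for some }\alpha\in\partial T(x^{-1})\}$$ is contained in $\Gamma^0$, and $x=\bigvee\partial t(x^{-1})$. In particular every gate is a join of tight gates (the identity being the empty join). 2. Every cone type is an intersection of cone types $T(z^{-1})$ of tight gates $z\in\Gamma^0$ (the cone type $W$ being the empty intersection). 3. For $x,y\in W$ let $x\sim y$ if, for all $w\in\Gamma^0$, $x\in T(w^{-1})$ if and only if $y\in T(w^{-1})$. The partition $\mathscr T^0$ of $W$ into the equivalence classes of $\sim$ equals $\mathscr T$. Hence $\mathscr T^0$ is a regular partition: on each part $P$ the left descent set $\{s\in S \mid \ell(sx)<\ell(x)\}$ does not depend on $x\in P$, and for every $s\in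 S$ outside this set, $sP$ is contained in a single part. -/

import Mathlib

noncomputable section

namespace ConeType

open Module Polynomial.Chebyshev

variable {B : Type*} {M : CoxeterMatrix B} {W : Type*} [Group W]

/-! ### The geometric representation and the root system -/

/-- The simple root `α_s`, a basis vector of the real vector space `V` with basis indexed by the
simple reflections. -/
def simpleRoot (s : B) : B →₀ ℝ := Finsupp.single s 1

/-- The symmetric bilinear form with `⟨α_s, α_t⟩ = -cos (π / m(s, t))`. In Mathlib `m(s, t) = ∞` is
encoded by `M s t = 0`, and then the value is `-cos 0 = -1`, as it should be. -/
def form (M : CoxeterMatrix B) : (B →₀ ℝ) →ₗ[ℝ] (B →₀ ℝ) →ₗ[ℝ] ℝ :=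
  Finsupp.linearCombination ℝ fun s =>
    Finsupp.linearCombination ℝ fun t => -Real.cos (Real.pi / (M s t : ℝ))

theorem form_simpleRoot (s t : B) :
    form M (simpleRoot s) (simpleRoot t) = -Real.cos (Real.pi / (M s t : ℝ)) := by
  simp [form, simpleRoot]

/-- The linear functional `v ↦ 2⟨v, α_s⟩`. -/
def simpleCoroot (M : CoxeterMatrix B) (s : B) : Dual ℝ (B →₀ ℝ) :=
  (2 : ℝ) • (form M).flip (simpleRoot s)

theorem simpleCoroot_apply (s : B) (v : B →₀ ℝ) :
    simpleCoroot M s v = 2 * form M v (simpleRoot s) := rfl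

theorem simpleCoroot_simpleRoot_self (s : B) : simpleCoroot M s (simpleRoot s) = 2 := by
  simp [simpleCoroot_apply, form_simpleRoot]

/-- The simple reflection `v ↦ v - 2⟨v, α_s⟩ α_s` on `V`. -/
def simpleReflection (M : CoxeterMatrix B) (s : B) : (B →₀ ℝ) ≃ₗ[ℝ] (B →₀ ℝ) :=
  Module.reflection (simpleCoroot_simpleRoot_self (M := M) s)

theorem simpleReflection_apply (s : B) (v : B →₀ ℝ) :
    simpleReflection M s v = v - (2 * form M v (simpleRoot s)) • simpleRoot s := rfl

/-- The simple reflections of `V` satisfy the Coxeter relations. -/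
theorem isLiftable_simpleReflection : M.IsLiftable (simpleReflection M) := by
  intro i j
  by_cases hij : i = j
  · subst hij
    rw [M.diagonal, pow_one]
    ext1 v
    exact Module.involutive_reflection (simpleCoroot_simpleRoot_self (M := M) i) v
  obtain h0 | h2 | h3 : M i j = 0 ∨ M i j = 2 ∨ 3 ≤ M i j := by
    have := M.off_diagonal i j hij
    omega
  · rw [h0, pow_zero]
  · have hc : ∀ v, simpleCoroot M i v = 2 * form M v (simpleRoot i) := fun _ => rfl
    have e1 : simpleCoroot M i (simpleRoot j) = 0 := by
      rw [hc, form_simpleRoot, M.symmetric j i, h2]; simp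
    have e2 : simpleCoroot M j (simpleRoot i) = 0 := by
      rw [simpleCoroot_apply, form_simpleRoot, h2]; simp
    rw [h2, pow_two]
    ext1 v
    simp only [LinearEquiv.mul_apply, simpleReflection, Module.reflection_apply, map_sub, map_smul,
      simpleCoroot_simpleRoot_self, e1, e2, LinearEquiv.coe_one, id_eq]
    module
  · set m := M i j with hm
    set θ : ℝ := 2 * Real.pi / m with hθ
    have hm0 : (0 : ℝ) < m := by exact_mod_cast (by omega : 0 < m)
    have hm3 : (3 : ℝ) ≤ m := by exact_mod_cast h3
    have hmθ : m * θ = 2 * Real.pi := by rw [hθ]; field_simp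
    have hsin : Real.sin θ ≠ 0 := by
      refine (Real.sin_pos_of_pos_of_lt_pi (by positivity) ?_).ne'
      rw [hθ, div_lt_iff₀ hm0]
      nlinarith [Real.pi_pos]
    have ht : 2 * Real.cos θ =
        simpleCoroot M i (simpleRoot j) * simpleCoroot M j (simpleRoot i) - 2 := by
      rw [simpleCoroot_apply, simpleCoroot_apply, form_simpleRoot, form_simpleRoot,
        M.symmetric j i, ← hm]
      have : θ = 2 * (Real.pi / m) := by rw [hθ]; ring
      rw [this, Real.cos_two_mul]
      ring
    have hS := fun k : ℤ => S_two_mul_real_cos θ k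
    ext1 v
    change ((Module.reflection (simpleCoroot_simpleRoot_self (M := M) i) *
      Module.reflection (simpleCoroot_simpleRoot_self (M := M) j)) ^ m) v = v
    rw [Module.reflection_mul_reflection_pow_apply _ _ m v _ ht]
    obtain ⟨k, hk⟩ | ⟨k, hk⟩ := Nat.even_or_odd m
    · have a1 : ((m : ℤ) - 2) / 2 = (k : ℤ) - 1 := by omega
      have a2 : ((m : ℤ) - 1) / 2 = (k : ℤ) - 1 := by omega
      have z : (S ℝ ((k : ℤ) - 1)).eval (2 * Real.cos θ) = 0 := by
        have := hS ((k : ℤ) - 1)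
        have hkθ : ((((k : ℤ) - 1 : ℤ) : ℝ) + 1) * θ = Real.pi := by
          have : (m : ℝ) = k + k := by exact_mod_cast hk
          push_cast
          rw [this] at hmθ
          linarith
        rw [hkθ, Real.sin_pi] at this
        exact (mul_eq_zero.1 this).resolve_right hsin
      rw [a1, a2, z]
      simp
    · have a1 : ((m : ℤ) - 2) / 2 = (k : ℤ) - 1 := by omega
      have a2 : ((m : ℤ) - 1) / 2 = (k : ℤ) := by omega
      have a3 : ((m : ℤ) - 3) / 2 = (k : ℤ) - 1 := by omega
      have a4 : (m : ℤ) / 2 = (k : ℤ) := by omega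
      have z : (S ℝ (k : ℤ)).eval (2 * Real.cos θ)
          + (S ℝ ((k : ℤ) - 1)).eval (2 * Real.cos θ) = 0 := by
        have h1 := hS (k : ℤ)
        have h2 := hS ((k : ℤ) - 1)
        have hkθ : (((k : ℤ) : ℝ) + 1) * θ = 2 * Real.pi - k * θ := by
          have : (m : ℝ) = 2 * k + 1 := by exact_mod_cast hk
          push_cast
          rw [this] at hmθ
          linarith
        rw [hkθ, Real.sin_two_pi_sub] at h1
        have h2' : (((k : ℤ) - 1 : ℤ) : ℝ) + 1 = k := by push_cast; ring
        rw [h2'] at h2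
        refine (mul_eq_zero.1 ?_).resolve_right hsin
        linear_combination h1 + h2
      rw [a1, a2, a3, a4, z]
      simp

/-- The action of `W` on `V`, in which a simple reflection `s` acts by
`v ↦ v - 2⟨v, α_s⟩ α_s`. -/
def geomRep (cs : CoxeterSystem M W) : W →* ((B →₀ ℝ) ≃ₗ[ℝ] (B →₀ ℝ)) :=
  cs.lift ⟨simpleReflection M, isLiftable_simpleReflection⟩

theorem geomRep_simple (cs : CoxeterSystem M W) (s : B) (v : B →₀ ℝ) :
    geomRep cs (cs.simple s) v = v - (2 * form M v (simpleRoot s)) • simpleRoot s := by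
  rw [geomRep, cs.lift_apply_simple isLiftable_simpleReflection, simpleReflection_apply]

/-- The root system `Φ = {w α_s}`. -/
def roots (cs : CoxeterSystem M W) : Set (B →₀ ℝ) :=
  {β | ∃ (w : W) (s : B), β = geomRep cs w (simpleRoot s)}

/-- The positive roots: all coefficients in the simple roots are nonnegative. -/
def posRoots (cs : CoxeterSystem M W) : Set (B →₀ ℝ) :=
  {β | β ∈ roots cs ∧ ∀ s, 0 ≤ β s}

/-- The negative roots: all coefficients in the simple roots are nonpositive. -/
def negRoots (cs : CoxeterSystem M W) : Set (B →₀ ℝ) :=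
  {β | β ∈ roots cs ∧ ∀ s, β s ≤ 0}

/-- The (left) inversion set `Φ(w) = {α ∈ Φ⁺ | w⁻¹ α < 0}`. -/
def inversions (cs : CoxeterSystem M W) (w : W) : Set (B →₀ ℝ) :=
  {α | α ∈ posRoots cs ∧ geomRep cs w⁻¹ α ∈ negRoots cs}

/-- The final roots (right-descent roots) `Φ^R(w) = {-w α_s | s ∈ D_R(w)}`. -/
def finalRoots (cs : CoxeterSystem M W) (w : W) : Set (B →₀ ℝ) :=
  {β | ∃ s, cs.IsRightDescent w s ∧ β = -geomRep cs w (simpleRoot s)}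

/-! ### The right weak order -/

/-- `x` is a prefix of `y`, that is, `x ≼ y` in the right weak order. -/
def IsPrefix (cs : CoxeterSystem M W) (x y : W) : Prop :=
  cs.length y = cs.length x + cs.length (x⁻¹ * y)

/-- `x` is the join (least upper bound) of the set `X` in the right weak order on `W`. -/
def IsJoin (cs : CoxeterSystem M W) (X : Set W) (x : W) : Prop :=
  (∀ z ∈ X, IsPrefix cs z x) ∧ ∀ y, (∀ z ∈ X, IsPrefix cs z y) → IsPrefix cs x y

/-! ### Cone types, their boundary roots and gates -/

/-- The cone type `T(w) = {v | ℓ(wv) = ℓ(w) + ℓ(v)}`. -/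
def coneType (cs : CoxeterSystem M W) (w : W) : Set W :=
  {v | cs.length (w * v) = cs.length w + cs.length v}

/-- The set of all cone types of `W`. -/
def coneTypes (cs : CoxeterSystem M W) : Set (Set W) := Set.range (coneType cs)

/-- The cone type part `Q(T) = {x | T(x⁻¹) = T}`. -/
def conePart (cs : CoxeterSystem M W) (T : Set W) : Set W := {x | coneType cs x⁻¹ = T}

/-- The cone type partition of `W`, with parts `Q(T)` for `T` a cone type. -/
def conePartition (cs : CoxeterSystem M W) : Set (Set W) := conePart cs '' coneTypes cs

/-- The boundary roots `∂T`: the positive roots `β` with `Φ(w) ∩ Φ(y) = {β}` for some `w ∈ Q(T)`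
and some `y ∈ W`. -/
def boundaryRoots (cs : CoxeterSystem M W) (T : Set W) : Set (B →₀ ℝ) :=
  {β | β ∈ posRoots cs ∧
    ∃ y : W, ∃ w ∈ conePart cs T, inversions cs w ∩ inversions cs y = {β}}

/-- The gates `Γ`: the minimal length elements of the cone type parts. -/
def gates (cs : CoxeterSystem M W) : Set W :=
  {g | ∃ T ∈ coneTypes cs, g ∈ conePart cs T ∧ ∀ x ∈ conePart cs T, cs.length g ≤ cs.length x}

/-- The tight gates `Γ⁰`: the gates with exactly one final root. -/
def tightGates (cs : CoxeterSystem M W) : Set W :=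
  {g | g ∈ gates cs ∧ (finalRoots cs g).ncard = 1}

/-- The set `∂t(x⁻¹)` of all prefixes `z` of `x` with `Φ^R(z) = {α}` for some boundary root `α` of
`T(x⁻¹)`. -/
def boundaryPrefixes (cs : CoxeterSystem M W) (x : W) : Set W :=
  {z | IsPrefix cs z x ∧ ∃ α ∈ boundaryRoots cs (coneType cs x⁻¹), finalRoots cs z = {α}}

/-- The relation `x ∼ y` if, for all tight gates `w`, `x ∈ T(w⁻¹)` if and only if
`y ∈ T(w⁻¹)`. -/
def tightSetoid (cs : CoxeterSystem M W) : Setoid W where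
  r x y := ∀ w ∈ tightGates cs, x ∈ coneType cs w⁻¹ ↔ y ∈ coneType cs w⁻¹
  iseqv :=
    { refl := fun _ _ _ => Iff.rfl
      symm := fun h w hw => (h w hw).symm
      trans := fun h k w hw => (h w hw).trans (k w hw) }

/-- A set of subsets of `W` is a regular partition if it is a partition of `W` such that the left
descent set is constant on each part `P`, and for each simple reflection `s` outside this descent
set, `sP` is contained in a single part. -/
def IsRegularPartition (cs : CoxeterSystem M W) (c : Set (Set W)) : Prop :=
  Setoid.IsPartition c ∧
  (∀ P ∈ c, ∀ x ∈ P, ∀ y ∈ P, ∀ s, cs.IsLeftDescent x s ↔ cs.IsLeftDescent y s) ∧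
  ∀ P ∈ c, ∀ s, (∀ x ∈ P, ¬ cs.IsLeftDescent x s) → ∃ P' ∈ c, ∀ x ∈ P, cs.simple s * x ∈ P'

end ConeType

end

namespace ConeType

variable {B : Type*} {M : CoxeterMatrix B} {W : Type*} [Group W]

/-! ### Dihedral words -/

/-! Everything is translated into inversion sets: `v ∈ T(x⁻¹)` means that `Φ(x)` and `Φ(v)` are
disjoint (`mem_coneType_inv_iff`), and `x ≼ y` means `Φ(x) ⊆ Φ(y)`. Both rest on the fact that each
root is positive or negative, which reduces to rank two: split off a dihedral suffix and compute
there.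

If `Φ(x)` meets `Φ(v)`, shortening `v` leaves a single common root, so `T(x⁻¹)` is the set of `v`
avoiding the boundary roots. That root is a final root of the shortened element, which does not
involve `x`; hence boundary roots are inversions of every member of the part.

The other ingredient is that parts are closed under meets (`exists_meet_mem_conePart`). Each
boundary root of `T(x⁻¹)` is the only final root of some prefix `z` of `x`. It is still a boundary
root of `T(z⁻¹)`, and no proper prefix of `z` has it as an inversion, so `z` is a tight gate. These
`z` together carry all boundary roots of `T(x⁻¹)`, so they determine `T(x⁻¹)`, and their join is `x`
when `x` is a gate. Symmetry of disjointness then identifies the two partitions. -/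

theorem exists_alternatingWord_eq_append (s t : B) {j k : ℕ} (h : j ≤ k) :
    ∃ X : List B, X.length = k - j ∧
      CoxeterSystem.alternatingWord s t k = X ++ CoxeterSystem.alternatingWord s t j := by
  induction k, h using Nat.le_induction with
  | base => exact ⟨[], by simp, rfl⟩
  | succ k hk ih =>
    obtain ⟨X, hX, e⟩ := ih
    refine ⟨(if Even k then t else s) :: X, by simp [hX]; omega, ?_⟩
    rw [CoxeterSystem.alternatingWord_succ', e, List.cons_append]

/-- An element with a right descent `t` factors with additive lengths as an element without right
descents in `{s, t}` followed by an alternating word ending in `t`. -/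
theorem exists_eq_mul_alternatingWord (cs : CoxeterSystem M W) {w : W} (s : B) {t : B}
    (ht : cs.IsRightDescent w t) :
    ∃ (v : W) (k : ℕ), w = v * cs.wordProd (CoxeterSystem.alternatingWord s t k) ∧
      cs.length w = cs.length v + k ∧ 0 < k ∧
      ¬ cs.IsRightDescent v s ∧ ¬ cs.IsRightDescent v t := by
  classical
  let p : ℕ → Prop := fun k => ∃ v : W,
    w = v * cs.wordProd (CoxeterSystem.alternatingWord s t k) ∧ cs.length w = cs.length v + k
  have hp1 : p 1 := by
    refine ⟨w * cs.simple t, ?_, ?_⟩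
    · simp [CoxeterSystem.alternatingWord]
    · exact (cs.isRightDescent_iff.1 ht).symm
  have hb : ∀ k, p k → k ≤ cs.length w := by
    rintro k ⟨v, -, h⟩
    omega
  have hl : 1 ≤ cs.length w := hb 1 hp1
  -- Take the longest alternating suffix. By maximality its next letter is not a descent of `v`; the
  -- other letter is the first of the suffix, so as a descent of `v` it would cancel and make `w`
  -- too short.
  set k := Nat.findGreatest p (cs.length w) with hk
  have hpk : p k := Nat.findGreatest_spec hl hp1
  have hk1 : 1 ≤ k := Nat.le_findGreatest hl hp1
  obtain ⟨v, hv, hlen⟩ := hpk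
  have up : ¬ cs.IsRightDescent v (if Even k then t else s) := by
    intro h
    have : p (k + 1) := by
      refine ⟨v * cs.simple (if Even k then t else s), ?_, ?_⟩
      · rw [CoxeterSystem.alternatingWord_succ', cs.wordProd_cons, mul_assoc,
          cs.simple_mul_simple_cancel_left]
        exact hv
      · have := cs.isRightDescent_iff.1 h
        omega
    have := Nat.le_findGreatest (hb _ this) this
    omega
  have down : ¬ cs.IsRightDescent v (if Even (k - 1) then t else s) := by
    intro h
    obtain ⟨j, hj⟩ : ∃ j, k = j + 1 := ⟨k - 1, by omega⟩
    rw [hj] at hv hlen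
    rw [hj, Nat.add_sub_cancel] at h
    rw [CoxeterSystem.alternatingWord_succ', cs.wordProd_cons, ← mul_assoc] at hv
    have h1 := cs.isRightDescent_iff.1 h
    have h2 := cs.length_mul_le (v * cs.simple (if Even j then t else s))
      (cs.wordProd (CoxeterSystem.alternatingWord s t j))
    have h3 := cs.length_wordProd_le (CoxeterSystem.alternatingWord s t j)
    rw [CoxeterSystem.length_alternatingWord] at h3
    rw [← hv] at h2
    omega
  refine ⟨v, k, hv, hlen, hk1, ?_⟩
  by_cases he : Even k
  · have : ¬ Even (k - 1) := by grind
    simp only [he, this, if_true, if_false] at up down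
    exact ⟨down, up⟩
  · have : Even (k - 1) := by grind
    simp only [he, this, if_true, if_false] at up down
    exact ⟨up, down⟩

/-! ### Positivity of roots -/

theorem geomRep_simple_simpleRoot_self (cs : CoxeterSystem M W) (s : B) :
    geomRep cs (cs.simple s) (simpleRoot s) = -simpleRoot s := by
  rw [geomRep_simple, form_simpleRoot, M.diagonal]
  simp only [Nat.cast_one, div_one, Real.cos_pi]
  module

theorem geomRep_simple_simpleRoot (cs : CoxeterSystem M W) (s t : B) :
    geomRep cs (cs.simple s) (simpleRoot t) =
      simpleRoot t + (2 * Real.cos (Real.pi / (M s t : ℝ))) • simpleRoot s := by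
  rw [geomRep_simple, form_simpleRoot, M.symmetric t s]
  module

/-- The coefficients of the roots of a dihedral root system. -/
theorem exists_dihedral_coeff (M : CoxeterMatrix B) {s t : B} (hst : s ≠ t) :
    ∃ p : ℕ → ℝ, p 0 = 0 ∧ p 1 = 1 ∧
      (∀ k, p (k + 2) = 2 * Real.cos (Real.pi / (M s t : ℝ)) * p (k + 1) - p k) ∧
      ∀ k, (M s t = 0 ∨ k ≤ M s t) → 0 ≤ p k := by
  obtain h0 | h2 : M s t = 0 ∨ 2 ≤ M s t := by
    have := M.off_diagonal s t hst
    omega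
  -- For `m = ∞` the cosine is `1` and the recurrence becomes that of an arithmetic progression.
  · refine ⟨fun k => k, by simp, by simp, fun k => ?_, fun k _ => by positivity⟩
    simp only [h0, Nat.cast_zero, div_zero, Real.cos_zero]
    push_cast
    ring
  · set θ := Real.pi / (M s t : ℝ) with hθ
    have hm : (2 : ℝ) ≤ M s t := by exact_mod_cast h2
    have hsin : 0 < Real.sin θ := by
      refine Real.sin_pos_of_pos_of_lt_pi (by positivity) ?_
      rw [hθ, div_lt_iff₀ (by positivity)]
      nlinarith [Real.pi_pos]
    -- Values of Chebyshev polynomials of the second kind; nonnegative as long as `k * θ ≤ π`, that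
    -- is `k ≤ m`.
    refine ⟨fun k => Real.sin (k * θ) / Real.sin θ, by simp, by simp [hsin.ne'], fun k => ?_,
      fun k hk => ?_⟩
    · have e1 : ((k + 2 : ℕ) : ℝ) * θ = ((k + 1 : ℕ) : ℝ) * θ + θ := by push_cast; ring
      have e2 : (k : ℝ) * θ = ((k + 1 : ℕ) : ℝ) * θ - θ := by push_cast; ring
      simp only [e1, e2, Real.sin_add, Real.sin_sub]
      field_simp
      ring
    · have hk' : (k : ℝ) ≤ M s t := by
        exact_mod_cast hk.resolve_left (by omega)
      refine div_nonneg (Real.sin_nonneg_of_nonneg_of_le_pi (by positivity) ?_) hsin.le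
      rw [hθ, mul_div_assoc', div_le_iff₀ (by positivity), mul_comm]
      exact mul_le_mul_of_nonneg_left hk' Real.pi_pos.le

/-- Each new letter reflects in the simple root carrying the older coefficient `p k`, replacing it
by `p (k + 2)`; this is the recurrence. -/
theorem geomRep_alternatingWord (cs : CoxeterSystem M W) {s t : B} {p : ℕ → ℝ}
    (h0 : p 0 = 0) (h1 : p 1 = 1)
    (hp : ∀ k, p (k + 2) = 2 * Real.cos (Real.pi / (M s t : ℝ)) * p (k + 1) - p k) (k : ℕ) :
    geomRep cs (cs.wordProd (CoxeterSystem.alternatingWord s t k)) (simpleRoot s) =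
      p (k + 1) • simpleRoot (if Even k then s else t) +
        p k • simpleRoot (if Even k then t else s) := by
  induction k with
  | zero => simp [CoxeterSystem.alternatingWord, h0, h1]
  | succ k ih =>
    rw [CoxeterSystem.alternatingWord_succ', cs.wordProd_cons, map_mul, LinearEquiv.mul_apply, ih]
    by_cases he : Even k
    · have : ¬ Even (k + 1) := by grind
      simp only [he, this, if_true, if_false, map_add, map_smul, geomRep_simple_simpleRoot_self,
        geomRep_simple_simpleRoot, hp, M.symmetric t s]
      module
    · have : Even (k + 1) := by grind
      simp only [he, this, if_true, if_false, map_add, map_smul, geomRep_simple_simpleRoot_self,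
        geomRep_simple_simpleRoot, hp]
      module

theorem simpleRoot_nonneg (s r : B) : 0 ≤ simpleRoot s r := by
  classical
  rw [simpleRoot, Finsupp.single_apply]
  split_ifs <;> norm_num

/-- If `ℓ(ws) > ℓ(w)` then `w α_s` is a positive root. -/
theorem geomRep_simpleRoot_nonneg (cs : CoxeterSystem M W) {w : W} {s : B}
    (hs : ¬ cs.IsRightDescent w s) (r : B) : 0 ≤ geomRep cs w (simpleRoot s) r := by
  induction hn : cs.length w using Nat.strong_induction_on generalizing w s with
  | _ n ih =>
    by_cases hw : w = 1
    · subst hw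
      simpa using simpleRoot_nonneg s r
    obtain ⟨t, ht⟩ := cs.exists_rightDescent_of_ne_one hw
    have hst : s ≠ t := by rintro rfl; exact hs ht
    obtain ⟨v, k, hv, hlen, hk, hvs, hvt⟩ := exists_eq_mul_alternatingWord cs s ht
    -- Otherwise the suffix contains a full braid word, which can be rewritten to end in `s`, making
    -- `ws` shorter than `w`. The bound is exactly what keeps both `p k` and `p (k + 1)`
    -- nonnegative.
    have hkm : M s t = 0 ∨ k + 1 ≤ M s t := by
      by_contra! hcon
      obtain ⟨hm, hmk⟩ := hcon
      obtain ⟨X, hX, e⟩ := exists_alternatingWord_eq_append s t (Nat.lt_succ_iff.1 hmk)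
      obtain ⟨j, hj⟩ : ∃ j, M s t = j + 1 := ⟨M s t - 1, by omega⟩
      have hb := cs.wordProd_braidWord_eq s t
      rw [CoxeterSystem.braidWord, CoxeterSystem.braidWord, M.symmetric t s] at hb
      have hws : w * cs.simple s = v * (cs.wordProd X *
          cs.wordProd (CoxeterSystem.alternatingWord s t j)) := by
        rw [hv, e, cs.wordProd_append, hb, hj, CoxeterSystem.alternatingWord_succ,
          cs.wordProd_concat]
        simp [mul_assoc]
      have l1 := cs.length_mul_le v (cs.wordProd X *
          cs.wordProd (CoxeterSystem.alternatingWord s t j))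
      have l2 := cs.length_mul_le (cs.wordProd X)
          (cs.wordProd (CoxeterSystem.alternatingWord s t j))
      have l3 := cs.length_wordProd_le X
      have l4 := cs.length_wordProd_le (CoxeterSystem.alternatingWord s t j)
      rw [CoxeterSystem.length_alternatingWord] at l4
      rw [← hws] at l1
      exact hs (show cs.length (w * cs.simple s) < cs.length w by omega)
    obtain ⟨p, h0, h1, hp, hpos⟩ := exists_dihedral_coeff M hst
    have is := ih (cs.length v) (by omega) hvs rfl
    have it := ih (cs.length v) (by omega) hvt rfl
    have q1 := hpos (k + 1) hkm
    have q2 := hpos k (hkm.imp id (by omega))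
    rw [hv, map_mul, LinearEquiv.mul_apply, geomRep_alternatingWord cs h0 h1 hp]
    simp only [map_add, map_smul, Finsupp.add_apply, Finsupp.smul_apply, smul_eq_mul]
    split_ifs <;> positivity

theorem geomRep_simpleRoot_nonpos (cs : CoxeterSystem M W) {w : W} {s : B}
    (hs : cs.IsRightDescent w s) (r : B) : geomRep cs w (simpleRoot s) r ≤ 0 := by
  have h := geomRep_simpleRoot_nonneg cs (cs.isRightDescent_iff_not_isRightDescent_mul.1 hs) r
  rw [map_mul, LinearEquiv.mul_apply, geomRep_simple_simpleRoot_self, map_neg,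
    Finsupp.neg_apply] at h
  linarith

/-! ### Roots -/

theorem simpleRoot_mem_posRoots (cs : CoxeterSystem M W) (s : B) :
    simpleRoot s ∈ posRoots cs :=
  ⟨⟨1, s, by simp⟩, simpleRoot_nonneg s⟩

theorem geomRep_mem_roots (cs : CoxeterSystem M W) (w : W) {β : B →₀ ℝ} (h : β ∈ roots cs) :
    geomRep cs w β ∈ roots cs := by
  obtain ⟨u, s, rfl⟩ := h
  exact ⟨w * u, s, by rw [map_mul, LinearEquiv.mul_apply]⟩

theorem neg_mem_roots (cs : CoxeterSystem M W) {β : B →₀ ℝ} (h : β ∈ roots cs) :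
    -β ∈ roots cs := by
  obtain ⟨u, s, rfl⟩ := h
  exact ⟨u * cs.simple s, s, by
    rw [map_mul, LinearEquiv.mul_apply, geomRep_simple_simpleRoot_self, map_neg]⟩

theorem neg_mem_posRoots_iff (cs : CoxeterSystem M W) {β : B →₀ ℝ} :
    -β ∈ posRoots cs ↔ β ∈ negRoots cs := by
  constructor
  · rintro ⟨h, h'⟩
    exact ⟨by simpa using neg_mem_roots cs h, fun s => by simpa using h' s⟩
  · rintro ⟨h, h'⟩
    exact ⟨neg_mem_roots cs h, fun s => by simpa using h' s⟩

theorem neg_mem_negRoots_iff (cs : CoxeterSystem M W) {β : B →₀ ℝ} :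
    -β ∈ negRoots cs ↔ β ∈ posRoots cs := by
  rw [← neg_mem_posRoots_iff, neg_neg]

theorem mem_posRoots_or_mem_negRoots (cs : CoxeterSystem M W) {β : B →₀ ℝ} (h : β ∈ roots cs) :
    β ∈ posRoots cs ∨ β ∈ negRoots cs := by
  obtain ⟨w, s, rfl⟩ := h
  by_cases hs : cs.IsRightDescent w s
  · exact Or.inr ⟨⟨w, s, rfl⟩, geomRep_simpleRoot_nonpos cs hs⟩
  · exact Or.inl ⟨⟨w, s, rfl⟩, geomRep_simpleRoot_nonneg cs hs⟩

theorem ne_zero_of_mem_roots (cs : CoxeterSystem M W) {β : B →₀ ℝ} (h : β ∈ roots cs) :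
    β ≠ 0 := by
  obtain ⟨w, s, rfl⟩ := h
  simp [simpleRoot]

theorem notMem_negRoots (cs : CoxeterSystem M W) {β : B →₀ ℝ} (h : β ∈ posRoots cs) :
    β ∉ negRoots cs := fun h' =>
  ne_zero_of_mem_roots cs h.1 (Finsupp.ext fun s => le_antisymm (h'.2 s) (h.2 s))

theorem isRightDescent_iff_mem_negRoots (cs : CoxeterSystem M W) (w : W) (s : B) :
    cs.IsRightDescent w s ↔ geomRep cs w (simpleRoot s) ∈ negRoots cs := by
  refine ⟨fun h => ⟨⟨w, s, rfl⟩, geomRep_simpleRoot_nonpos cs h⟩, fun h => ?_⟩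
  by_contra hs
  exact notMem_negRoots cs ⟨⟨w, s, rfl⟩, geomRep_simpleRoot_nonneg cs hs⟩ h

theorem not_isRightDescent_iff_mem_posRoots (cs : CoxeterSystem M W) (w : W) (s : B) :
    ¬ cs.IsRightDescent w s ↔ geomRep cs w (simpleRoot s) ∈ posRoots cs := by
  refine ⟨fun h => ⟨⟨w, s, rfl⟩, geomRep_simpleRoot_nonneg cs h⟩, fun h h' => ?_⟩
  exact notMem_negRoots cs h ((isRightDescent_iff_mem_negRoots cs w s).1 h')

theorem form_comm (u v : B →₀ ℝ) : form M u v = form M v u := by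
  have : form M = (form M).flip := by
    refine Finsupp.lhom_ext' fun s => LinearMap.ext_ring (Finsupp.lhom_ext' fun t =>
      LinearMap.ext_ring ?_)
    have h1 := form_simpleRoot (M := M) s t
    have h2 := form_simpleRoot (M := M) t s
    rw [M.symmetric t s, ← h1] at h2
    exact h2.symm
  rw [this, LinearMap.flip_apply, ← this]

theorem form_geomRep (cs : CoxeterSystem M W) (w : W) (u v : B →₀ ℝ) :
    form M (geomRep cs w u) (geomRep cs w v) = form M u v := by
  induction w using cs.simple_induction_left generalizing u v with
  | one => simp
  | mul_simple_left w s ih =>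
    rw [map_mul, LinearEquiv.mul_apply, LinearEquiv.mul_apply, ← ih u v, geomRep_simple,
      geomRep_simple]
    have h := form_simpleRoot (M := M) s s
    rw [M.diagonal] at h
    simp only [Nat.cast_one, div_one, Real.cos_pi, neg_neg] at h
    simp only [map_sub, map_smul, LinearMap.sub_apply, LinearMap.smul_apply, smul_eq_mul, h,
      form_comm (simpleRoot s)]
    ring

theorem form_self_of_mem_roots (cs : CoxeterSystem M W) {β : B →₀ ℝ} (h : β ∈ roots cs) :
    form M β β = 1 := by
  obtain ⟨w, s, rfl⟩ := h
  rw [form_geomRep, form_simpleRoot, M.diagonal]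
  simp

/-- The simple reflection `s` permutes the positive roots other than `α_s`. -/
theorem geomRep_simple_mem_posRoots (cs : CoxeterSystem M W) {s : B} {β : B →₀ ℝ}
    (h : β ∈ posRoots cs) (hne : β ≠ simpleRoot s) :
    geomRep cs (cs.simple s) β ∈ posRoots cs := by
  classical
  refine (mem_posRoots_or_mem_negRoots cs (geomRep_mem_roots cs _ h.1)).resolve_right
    fun hneg => hne ?_
  -- The reflection alters only the coefficient at `s`, so a sign change forces `β` to be a multiple
  -- of `α_s`; both have norm one.
  have hr : ∀ r, r ≠ s → β r = 0 := by
    intro r hrs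
    have := hneg.2 r
    rw [geomRep_simple] at this
    simp only [Finsupp.sub_apply, Finsupp.smul_apply, simpleRoot, Finsupp.single_apply,
      if_neg hrs.symm, smul_zero, sub_zero] at this
    exact le_antisymm this (h.2 r)
  have hβ : β = β s • simpleRoot s := by
    ext r
    by_cases hrs : r = s
    · subst hrs
      simp [simpleRoot]
    · simp [simpleRoot, hr r hrs, Ne.symm hrs]
  have hf := form_self_of_mem_roots cs h.1
  have hs := form_self_of_mem_roots cs (simpleRoot_mem_posRoots cs s).1
  rw [hβ] at hf
  simp only [map_smul, LinearMap.smul_apply, smul_eq_mul, hs] at hf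
  have : β s = 1 := by nlinarith [h.2 s]
  rw [hβ, this, one_smul]

/-! ### Inversion sets -/

theorem geomRep_inv_apply_self (cs : CoxeterSystem M W) (w : W) (v : B →₀ ℝ) :
    geomRep cs w⁻¹ (geomRep cs w v) = v := by
  rw [← LinearEquiv.mul_apply, ← map_mul, inv_mul_cancel, map_one, LinearEquiv.coe_one, id]

theorem geomRep_apply_inv_self (cs : CoxeterSystem M W) (w : W) (v : B →₀ ℝ) :
    geomRep cs w (geomRep cs w⁻¹ v) = v := by
  rw [← LinearEquiv.mul_apply, ← map_mul, mul_inv_cancel, map_one, LinearEquiv.coe_one, id]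

theorem inversions_one (cs : CoxeterSystem M W) : inversions cs 1 = ∅ := by
  ext α
  simp only [inversions, inv_one, map_one, LinearEquiv.coe_one, id, Set.mem_ofPred_eq,
    Set.mem_empty_iff_false, iff_false, not_and]
  exact fun h => notMem_negRoots cs h

/-- Since `s` permutes the positive roots other than `α_s`, only the root `wα_s` can change status.
-/
theorem inversions_mul_simple (cs : CoxeterSystem M W) {w : W} {s : B}
    (hs : ¬ cs.IsRightDescent w s) :
    inversions cs (w * cs.simple s) = insert (geomRep cs w (simpleRoot s)) (inversions cs w) := by
  have hpos := (not_isRightDescent_iff_mem_posRoots cs w s).1 hs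
  have e : ∀ α, geomRep cs (w * cs.simple s)⁻¹ α =
      geomRep cs (cs.simple s) (geomRep cs w⁻¹ α) := by
    intro α
    rw [mul_inv_rev, cs.inv_simple, map_mul, LinearEquiv.mul_apply]
  ext α
  constructor
  · rintro ⟨hα, hneg⟩
    rw [e] at hneg
    by_cases h : geomRep cs w⁻¹ α = simpleRoot s
    · left
      rw [← h, geomRep_apply_inv_self]
    · right
      refine ⟨hα, (mem_posRoots_or_mem_negRoots cs (geomRep_mem_roots cs _ hα.1)).resolve_left
        fun hp => ?_⟩
      exact notMem_negRoots cs (geomRep_simple_mem_posRoots cs hp h) hneg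
  · rintro (rfl | ⟨hα, hneg⟩)
    · refine ⟨hpos, ?_⟩
      rw [e, geomRep_inv_apply_self, geomRep_simple_simpleRoot_self, neg_mem_negRoots_iff]
      exact simpleRoot_mem_posRoots cs s
    · refine ⟨hα, ?_⟩
      rw [e, ← neg_mem_posRoots_iff, ← map_neg]
      refine geomRep_simple_mem_posRoots cs ((neg_mem_posRoots_iff cs).2 hneg) fun h => ?_
      have : geomRep cs w (simpleRoot s) = -α := by
        rw [← h, map_neg, geomRep_apply_inv_self]
      rw [this, neg_mem_posRoots_iff] at hpos
      exact notMem_negRoots cs hα hpos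

theorem inversions_eq_insert (cs : CoxeterSystem M W) {w : W} {s : B}
    (hs : cs.IsRightDescent w s) :
    inversions cs w =
      insert (-geomRep cs w (simpleRoot s)) (inversions cs (w * cs.simple s)) := by
  have := inversions_mul_simple cs (cs.isRightDescent_iff_not_isRightDescent_mul.1 hs)
  rwa [cs.simple_mul_simple_cancel_right, map_mul, LinearEquiv.mul_apply,
    geomRep_simple_simpleRoot_self, map_neg] at this

theorem neg_geomRep_notMem_inversions_mul_simple (cs : CoxeterSystem M W) (w : W) (s : B) :
    -geomRep cs w (simpleRoot s) ∉ inversions cs (w * cs.simple s) := by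
  rintro ⟨-, h⟩
  rw [mul_inv_rev, cs.inv_simple, map_mul, LinearEquiv.mul_apply, map_neg,
    geomRep_inv_apply_self, map_neg, geomRep_simple_simpleRoot_self, neg_neg] at h
  exact notMem_negRoots cs (simpleRoot_mem_posRoots cs s) h

theorem inversions_subset_mul (cs : CoxeterSystem M W) {x y : W}
    (h : cs.length (x * y) = cs.length x + cs.length y) :
    inversions cs x ⊆ inversions cs (x * y) := by
  induction hn : cs.length y generalizing y with
  | zero =>
    rw [cs.length_eq_zero_iff.1 hn, mul_one]
  | succ n ih =>
    have hy : y ≠ 1 := by rintro rfl; simp at hn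
    obtain ⟨s, hs⟩ := cs.exists_rightDescent_of_ne_one hy
    have h1 := cs.isRightDescent_iff.1 hs
    have h2 := cs.length_mul_le x (y * cs.simple s)
    have h3 := cs.length_mul_simple (x * y) s
    rw [mul_assoc] at h3
    have hd : cs.IsRightDescent (x * y) s := by
      rw [cs.isRightDescent_iff, mul_assoc]
      omega
    have := ih (y := y * cs.simple s) (by omega) (by omega)
    rw [← mul_assoc] at this
    rw [inversions_eq_insert cs hd]
    exact this.trans (Set.subset_insert _ _)

/-- For `α` in `Φ(x⁻¹)`, the root `-xα` lies in `Φ(x) ⊆ Φ(xy)`; applying `(xy)⁻¹` shows that `y⁻¹α`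
is positive. -/
theorem disjoint_inversions_of_length_mul (cs : CoxeterSystem M W) {x y : W}
    (h : cs.length (x * y) = cs.length x + cs.length y) :
    Disjoint (inversions cs x⁻¹) (inversions cs y) := by
  rw [Set.disjoint_left]
  rintro α ⟨hα, hx⟩ ⟨-, hy⟩
  rw [inv_inv] at hx
  have hmem : -geomRep cs x α ∈ inversions cs x := by
    refine ⟨(neg_mem_posRoots_iff cs).2 hx, ?_⟩
    rwa [map_neg, geomRep_inv_apply_self, neg_mem_negRoots_iff]
  have := (inversions_subset_mul cs h hmem).2
  rw [mul_inv_rev, map_mul, LinearEquiv.mul_apply, map_neg, geomRep_inv_apply_self, map_neg,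
    neg_mem_negRoots_iff] at this
  exact notMem_negRoots cs this hy

theorem length_mul_of_disjoint_inversions (cs : CoxeterSystem M W) {x y : W}
    (h : Disjoint (inversions cs x⁻¹) (inversions cs y)) :
    cs.length (x * y) = cs.length x + cs.length y := by
  induction hn : cs.length y generalizing y with
  | zero => simp [cs.length_eq_zero_iff.1 hn]
  | succ n ih =>
    have hy : y ≠ 1 := by rintro rfl; simp at hn
    obtain ⟨s, hs⟩ := cs.exists_rightDescent_of_ne_one hy
    have h1 := cs.isRightDescent_iff.1 hs
    rw [inversions_eq_insert cs hs, Set.disjoint_insert_right] at h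
    have h2 := ih h.2 (by omega)
    have hneg := (isRightDescent_iff_mem_negRoots cs y s).1 hs
    have hnd : ¬ cs.IsRightDescent (x * (y * cs.simple s)) s := by
      rw [isRightDescent_iff_mem_negRoots]
      intro hd
      -- If appending the last letter `s` of `y` shortened the product, `x` would send the final
      -- root `-yα_s` to a negative root.
      refine h.1 ⟨(neg_mem_posRoots_iff cs).2 hneg, ?_⟩
      rwa [map_mul, LinearEquiv.mul_apply, map_mul, LinearEquiv.mul_apply,
        geomRep_simple_simpleRoot_self, map_neg, ← inv_inv x] at hd
    have h3 := cs.not_isRightDescent_iff.1 hnd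
    rw [mul_assoc, cs.simple_mul_simple_cancel_right] at h3
    omega

theorem mem_coneType_inv_iff (cs : CoxeterSystem M W) {x v : W} :
    v ∈ coneType cs x⁻¹ ↔ Disjoint (inversions cs x) (inversions cs v) := by
  refine ⟨fun h => by simpa using disjoint_inversions_of_length_mul cs h, fun h => ?_⟩
  exact length_mul_of_disjoint_inversions cs (by simpa using h)

theorem mem_coneType_inv_comm (cs : CoxeterSystem M W) {x y : W} :
    y ∈ coneType cs x⁻¹ ↔ x ∈ coneType cs y⁻¹ := by
  rw [mem_coneType_inv_iff, mem_coneType_inv_iff, disjoint_comm]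

theorem isPrefix_iff_inversions_subset (cs : CoxeterSystem M W) {x y : W} :
    IsPrefix cs x y ↔ inversions cs x ⊆ inversions cs y := by
  constructor
  · intro h
    have := inversions_subset_mul cs (x := x) (y := x⁻¹ * y) (by rwa [mul_inv_cancel_left])
    rwa [mul_inv_cancel_left] at this
  · intro h
    have : Disjoint (inversions cs x⁻¹) (inversions cs (x⁻¹ * y)) := by
      rw [Set.disjoint_left]
      rintro α ⟨hα, hx⟩ ⟨-, hy⟩
      rw [inv_inv] at hx
      rw [mul_inv_rev, inv_inv, map_mul, LinearEquiv.mul_apply] at hy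
      have hmem : -geomRep cs x α ∈ inversions cs x := by
        refine ⟨(neg_mem_posRoots_iff cs).2 hx, ?_⟩
        rwa [map_neg, geomRep_inv_apply_self, neg_mem_negRoots_iff]
      have h2 := (h hmem).2
      rw [map_neg, neg_mem_negRoots_iff] at h2
      exact notMem_negRoots cs h2 hy
    have := length_mul_of_disjoint_inversions cs this
    rwa [mul_inv_cancel_left] at this

/-! ### The weak order -/

theorem IsPrefix.refl (cs : CoxeterSystem M W) (x : W) : IsPrefix cs x x := by
  simp [IsPrefix]

theorem IsPrefix.trans {cs : CoxeterSystem M W} {x y z : W} (h : IsPrefix cs x y)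
    (h' : IsPrefix cs y z) : IsPrefix cs x z := by
  rw [isPrefix_iff_inversions_subset] at *
  exact h.trans h'

theorem IsPrefix.length_le {cs : CoxeterSystem M W} {x y : W} (h : IsPrefix cs x y) :
    cs.length x ≤ cs.length y := by
  rw [IsPrefix] at h
  omega

theorem IsPrefix.eq_of_length_le {cs : CoxeterSystem M W} {x y : W} (h : IsPrefix cs x y)
    (hl : cs.length y ≤ cs.length x) : x = y := by
  rw [IsPrefix] at h
  exact inv_mul_eq_one.1 (cs.length_eq_zero_iff.1 (by omega))

theorem IsPrefix.coneType_inv_subset {cs : CoxeterSystem M W} {x y : W} (h : IsPrefix cs x y) :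
    coneType cs y⁻¹ ⊆ coneType cs x⁻¹ := by
  intro v hv
  rw [mem_coneType_inv_iff] at *
  exact hv.mono_left ((isPrefix_iff_inversions_subset cs).1 h)

theorem isPrefix_one (cs : CoxeterSystem M W) (x : W) : IsPrefix cs 1 x := by
  simp [IsPrefix]

theorem isPrefix_mul_simple (cs : CoxeterSystem M W) {x : W} {s : B}
    (h : cs.IsRightDescent x s) : IsPrefix cs (x * cs.simple s) x := by
  rw [isPrefix_iff_inversions_subset, inversions_eq_insert cs h]
  exact Set.subset_insert _ _

/-- A proper prefix of `z` is a prefix of `zs` for some right descent `s` of `z`. -/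
theorem IsPrefix.exists_isPrefix_mul_simple {cs : CoxeterSystem M W} {u z : W}
    (h : IsPrefix cs u z) (hne : u ≠ z) :
    ∃ s, cs.IsRightDescent z s ∧ IsPrefix cs u (z * cs.simple s) := by
  have hne' : u⁻¹ * z ≠ 1 := fun h' => hne (inv_mul_eq_one.1 h')
  obtain ⟨s, hs⟩ := cs.exists_rightDescent_of_ne_one hne'
  have h1 := cs.isRightDescent_iff.1 hs
  have h2 := cs.length_mul_le u (u⁻¹ * z * cs.simple s)
  have h3 := cs.length_mul_simple z s
  have e : u * (u⁻¹ * z * cs.simple s) = z * cs.simple s := by group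
  rw [e] at h2
  rw [IsPrefix] at h
  refine ⟨s, cs.isRightDescent_iff.2 (by omega), ?_⟩
  rw [IsPrefix, ← mul_assoc]
  omega

theorem isPrefix_simple_mul_iff (cs : CoxeterSystem M W) {x y : W} {s : B}
    (hx : cs.IsLeftDescent x s) (hy : cs.IsLeftDescent y s) :
    IsPrefix cs (cs.simple s * x) (cs.simple s * y) ↔ IsPrefix cs x y := by
  have h1 := cs.isLeftDescent_iff.1 hx
  have h2 := cs.isLeftDescent_iff.1 hy
  have e : (cs.simple s * x)⁻¹ * (cs.simple s * y) = x⁻¹ * y := by group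
  rw [IsPrefix, IsPrefix, e]
  omega

theorem isLeftDescent_iff_isPrefix (cs : CoxeterSystem M W) {x : W} {s : B} :
    cs.IsLeftDescent x s ↔ IsPrefix cs (cs.simple s) x := by
  rw [cs.isLeftDescent_iff, IsPrefix, cs.inv_simple, cs.length_simple, add_comm, eq_comm]

theorem IsPrefix.isLeftDescent {cs : CoxeterSystem M W} {x y : W} {s : B}
    (h : IsPrefix cs x y) (hs : cs.IsLeftDescent x s) : cs.IsLeftDescent y s := by
  rw [isLeftDescent_iff_isPrefix] at *
  exact hs.trans h

/-- An element with two right descents `s ≠ t` has a suffix in the dihedral subgroup generated by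
`s` and `t` with both right descents. -/
theorem exists_alternatingWord_suffix (cs : CoxeterSystem M W) {x : W} {s t : B} (hst : s ≠ t)
    (hs : cs.IsRightDescent x s) (ht : cs.IsRightDescent x t) :
    ∃ (v : W) (k : ℕ), x = v * cs.wordProd (CoxeterSystem.alternatingWord s t k) ∧
      cs.length x = cs.length v + k ∧
      cs.IsRightDescent (cs.wordProd (CoxeterSystem.alternatingWord s t k)) s ∧
      cs.IsRightDescent (cs.wordProd (CoxeterSystem.alternatingWord s t k)) t := by
  obtain ⟨v, k, hx, hl, hk, hvs, hvt⟩ := exists_eq_mul_alternatingWord cs s ht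
  refine ⟨v, k, hx, hl, ?_, ?_⟩
  · by_contra hcon
    obtain ⟨p, h0, h1, hp, -⟩ := exists_dihedral_coeff M hst
    have ha := (not_isRightDescent_iff_mem_posRoots cs _ s).1 hcon
    have hxs := (isRightDescent_iff_mem_negRoots cs x s).1 hs
    refine notMem_negRoots cs ⟨geomRep_mem_roots cs x (simpleRoot_mem_posRoots cs s).1, ?_⟩ hxs
    have hvs' := geomRep_simpleRoot_nonneg cs hvs
    have hvt' := geomRep_simpleRoot_nonneg cs hvt
    have e := geomRep_alternatingWord cs h0 h1 hp k
    rw [e] at ha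
    have hc : 0 ≤ p (k + 1) ∧ 0 ≤ p k := by
      have c1 := ha.2 s
      have c2 := ha.2 t
      by_cases he : Even k <;>
        simp [simpleRoot, he, hst, hst.symm] at c1 c2 <;> exact ⟨by assumption, by assumption⟩
    intro r
    rw [hx, map_mul, LinearEquiv.mul_apply, e]
    have c1 := hc.1
    have c2 := hc.2
    have r1 := hvs' r
    have r2 := hvt' r
    simp only [map_add, map_smul, Finsupp.add_apply, Finsupp.smul_apply, smul_eq_mul]
    split_ifs <;> positivity
  · obtain ⟨j, rfl⟩ : ∃ j, k = j + 1 := ⟨k - 1, by omega⟩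
    have h1 := cs.length_mul_le v (cs.wordProd (CoxeterSystem.alternatingWord s t (j + 1)))
    have h2 := cs.length_wordProd_le (CoxeterSystem.alternatingWord t s j)
    rw [← hx] at h1
    rw [CoxeterSystem.length_alternatingWord] at h2
    rw [CoxeterSystem.IsRightDescent]
    rw [CoxeterSystem.alternatingWord_succ, cs.wordProd_concat] at h1 ⊢
    rw [cs.simple_mul_simple_cancel_right]
    omega

/-- The dihedral suffixes of `x⁻¹` and `y⁻¹` are alternating words ending in the same letter, hence
nested; the shorter one serves both. -/
theorem exists_isPrefix_of_isLeftDescent (cs : CoxeterSystem M W) {x y : W} {s t : B}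
    (hxs : cs.IsLeftDescent x s) (hxt : cs.IsLeftDescent x t)
    (hys : cs.IsLeftDescent y s) (hyt : cs.IsLeftDescent y t) :
    ∃ u, IsPrefix cs u x ∧ IsPrefix cs u y ∧ cs.IsLeftDescent u s ∧ cs.IsLeftDescent u t := by
  by_cases hst : s = t
  · subst hst
    exact ⟨cs.simple s, (isLeftDescent_iff_isPrefix cs).1 hxs,
      (isLeftDescent_iff_isPrefix cs).1 hys, (isLeftDescent_iff_isPrefix cs).2 (.refl cs _),
      (isLeftDescent_iff_isPrefix cs).2 (.refl cs _)⟩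
  rw [← cs.isRightDescent_inv_iff] at hxs hxt hys hyt
  obtain ⟨v, k, hx, hxl, hks, hkt⟩ := exists_alternatingWord_suffix cs hst hxs hxt
  obtain ⟨v', k', hy, hyl, hks', hkt'⟩ := exists_alternatingWord_suffix cs hst hys hyt
  have key : ∀ {x v : W} {j k : ℕ}, j ≤ k →
      x⁻¹ = v * cs.wordProd (CoxeterSystem.alternatingWord s t k) →
      cs.length x⁻¹ = cs.length v + k →
      IsPrefix cs (cs.wordProd (CoxeterSystem.alternatingWord s t j))⁻¹ x := by
    intro x v j k hjk hx hxl
    obtain ⟨X, hX, e⟩ := exists_alternatingWord_eq_append s t hjk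
    rw [e, cs.wordProd_append, ← mul_assoc] at hx
    have l1 := cs.length_mul_le v (cs.wordProd X)
    have l2 := cs.length_wordProd_le X
    have l3 := cs.length_wordProd_le (CoxeterSystem.alternatingWord s t j)
    rw [CoxeterSystem.length_alternatingWord] at l3
    have l4 := cs.length_mul_le (v * cs.wordProd X)
      (cs.wordProd (CoxeterSystem.alternatingWord s t j))
    rw [← hx] at l4
    have hx' : cs.wordProd (CoxeterSystem.alternatingWord s t j) * x = (v * cs.wordProd X)⁻¹ := by
      rw [← inv_inv x, hx]
      group
    rw [cs.length_inv] at hxl l4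
    rw [IsPrefix, inv_inv, hx', cs.length_inv, cs.length_inv]
    omega
  obtain h | h := le_total k k'
  · exact ⟨_, key le_rfl hx hxl, key h hy hyl, cs.isLeftDescent_inv_iff.2 hks,
      cs.isLeftDescent_inv_iff.2 hkt⟩
  · exact ⟨_, key h hx hxl, key le_rfl hy hyl, cs.isLeftDescent_inv_iff.2 hks',
      cs.isLeftDescent_inv_iff.2 hkt'⟩

/-- Any two elements have a meet in the weak order. -/
theorem exists_meet (cs : CoxeterSystem M W) (x y : W) :
    ∃ z, IsPrefix cs z x ∧ IsPrefix cs z y ∧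
      ∀ u, IsPrefix cs u x → IsPrefix cs u y → IsPrefix cs u z := by
  induction hn : cs.length x using Nat.strong_induction_on generalizing x y with
  | _ n ih =>
    -- Among common prefixes beginning with `s` there is a greatest one: strip `s` and use
    -- induction.
    have step : ∀ s, cs.IsLeftDescent x s → cs.IsLeftDescent y s →
        ∃ z, IsPrefix cs z x ∧ IsPrefix cs z y ∧ cs.IsLeftDescent z s ∧
          ∀ u, cs.IsLeftDescent u s → IsPrefix cs u x → IsPrefix cs u y → IsPrefix cs u z := by
      intro s hx hy
      have hlt : cs.length (cs.simple s * x) < n := hn ▸ hx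
      obtain ⟨z, hzx, hzy, hz⟩ := ih _ hlt (cs.simple s * x) (cs.simple s * y) rfl
      have hzs : cs.IsLeftDescent (cs.simple s * z) s := by
        rw [cs.isLeftDescent_iff_not_isLeftDescent_mul, cs.simple_mul_simple_cancel_left]
        intro h
        exact cs.isLeftDescent_iff_not_isLeftDescent_mul.1 hx (hzx.isLeftDescent h)
      refine ⟨cs.simple s * z, ?_, ?_, hzs, fun u hu hux huy => ?_⟩
      · rwa [← isPrefix_simple_mul_iff cs hzs hx, cs.simple_mul_simple_cancel_left]
      · rwa [← isPrefix_simple_mul_iff cs hzs hy, cs.simple_mul_simple_cancel_left]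
      · rw [← isPrefix_simple_mul_iff cs hu hzs, cs.simple_mul_simple_cancel_left]
        exact hz _ ((isPrefix_simple_mul_iff cs hu hx).2 hux)
          ((isPrefix_simple_mul_iff cs hu hy).2 huy)
    by_cases hex : ∃ s, cs.IsLeftDescent x s ∧ cs.IsLeftDescent y s
    · obtain ⟨s, hx, hy⟩ := hex
      obtain ⟨z, hzx, hzy, hzs, hz⟩ := step s hx hy
      refine ⟨z, hzx, hzy, fun u hux huy => ?_⟩
      by_cases hu : u = 1
      · rw [hu]
        exact isPrefix_one cs z
      obtain ⟨t, ht⟩ := cs.exists_leftDescent_of_ne_one hu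
      -- The greatest common prefixes for `s` and `t` are compared through a dihedral common prefix
      -- `d` having both descents: `d ≼ z'` gives `z'` the descent `s`, so `z' ≼ z`.
      obtain ⟨z', hzx', hzy', hzt', hz'⟩ := step t (hux.isLeftDescent ht) (huy.isLeftDescent ht)
      obtain ⟨d, hdx, hdy, hds, hdt⟩ := exists_isPrefix_of_isLeftDescent cs hx
        (hux.isLeftDescent ht) hy (huy.isLeftDescent ht)
      exact (hz' u ht hux huy).trans (hz z' ((hz' d hdt hdx hdy).isLeftDescent hds) hzx' hzy')
    · refine ⟨1, isPrefix_one cs x, isPrefix_one cs y, fun u hux huy => ?_⟩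
      by_cases hu : u = 1
      · rw [hu]
        exact isPrefix_one cs 1
      obtain ⟨t, ht⟩ := cs.exists_leftDescent_of_ne_one hu
      exact (hex ⟨t, hux.isLeftDescent ht, huy.isLeftDescent ht⟩).elim

/-! ### Cone types and gates -/

theorem simple_mem_coneType_inv_iff (cs : CoxeterSystem M W) {x : W} {s : B} :
    cs.simple s ∈ coneType cs x⁻¹ ↔ ¬ cs.IsLeftDescent x s := by
  rw [← cs.isRightDescent_inv_iff, cs.not_isRightDescent_iff, coneType, Set.mem_ofPred_eq,
    cs.length_simple]

/-- The right side depends on `x` only through `T(x⁻¹)`. This gives regularity and drives the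
induction for meets. -/
theorem mem_coneType_inv_simple_mul_iff (cs : CoxeterSystem M W) {x v : W} {s : B}
    (hs : ¬ cs.IsLeftDescent x s) :
    v ∈ coneType cs (cs.simple s * x)⁻¹ ↔
      cs.simple s * v ∈ coneType cs x⁻¹ ∧ ¬ cs.IsLeftDescent v s := by
  have h1 := cs.not_isLeftDescent_iff.1 hs
  have h2 := cs.length_mul_le x⁻¹ (cs.simple s * v)
  have h3 := cs.length_simple_mul v s
  rw [cs.not_isLeftDescent_iff]
  simp only [coneType, Set.mem_ofPred_eq, mul_inv_rev, cs.inv_simple, mul_assoc]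
  rw [← cs.length_inv (x⁻¹ * cs.simple s), mul_inv_rev, inv_inv, cs.inv_simple, cs.length_inv,
    h1]
  rw [cs.length_inv] at h2
  omega

/-- If `x` and `y` have equal cone types then so does their meet. -/
theorem coneType_inv_subset_of_meet (cs : CoxeterSystem M W) {x y z v : W}
    (hxy : coneType cs x⁻¹ = coneType cs y⁻¹) (hzx : IsPrefix cs z x) (hzy : IsPrefix cs z y)
    (hz : ∀ u, IsPrefix cs u x → IsPrefix cs u y → IsPrefix cs u z)
    (hv : v ∈ coneType cs z⁻¹) : v ∈ coneType cs x⁻¹ := by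
  induction hn : cs.length v generalizing x y z v with
  | zero =>
    rw [cs.length_eq_zero_iff.1 hn]
    simp [coneType]
  | succ n ih =>
    have hv1 : v ≠ 1 := by rintro rfl; simp at hn
    obtain ⟨s, hs⟩ := cs.exists_leftDescent_of_ne_one hv1
    have hlen := cs.isLeftDescent_iff.1 hs
    have hsv := (isLeftDescent_iff_isPrefix cs).1 hs
    have hzs : ¬ cs.IsLeftDescent z s := by
      rw [← simple_mem_coneType_inv_iff, mem_coneType_inv_iff]
      exact ((mem_coneType_inv_iff cs).1 hv).mono_right ((isPrefix_iff_inversions_subset cs).1 hsv)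
    -- Cone types determine descents, so `s` is a descent of both or neither; of both is impossible,
    -- as `s` would then be a prefix of the meet `z`.
    have hiff : cs.IsLeftDescent x s ↔ cs.IsLeftDescent y s := by
      rw [← not_iff_not, ← simple_mem_coneType_inv_iff, ← simple_mem_coneType_inv_iff, hxy]
    have hxs : ¬ cs.IsLeftDescent x s := fun h => hzs <| (isLeftDescent_iff_isPrefix cs).2 <|
      hz _ ((isLeftDescent_iff_isPrefix cs).1 h) ((isLeftDescent_iff_isPrefix cs).1 (hiff.1 h))
    have hys : ¬ cs.IsLeftDescent y s := fun h => hxs (hiff.2 h)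
    have desc : ∀ {w : W}, ¬ cs.IsLeftDescent w s → cs.IsLeftDescent (cs.simple s * w) s := by
      intro w hw
      rwa [cs.isLeftDescent_iff_not_isLeftDescent_mul, cs.simple_mul_simple_cancel_left]
    have hvs := cs.isLeftDescent_iff_not_isLeftDescent_mul.1 hs
    have mem : ∀ {w : W}, ¬ cs.IsLeftDescent w s →
        (cs.simple s * v ∈ coneType cs (cs.simple s * w)⁻¹ ↔ v ∈ coneType cs w⁻¹) := by
      intro w hw
      rw [mem_coneType_inv_simple_mul_iff cs hw, cs.simple_mul_simple_cancel_left]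
      exact and_iff_left hvs
    have up : ∀ {w : W}, ¬ cs.IsLeftDescent w s → IsPrefix cs z w →
        IsPrefix cs (cs.simple s * z) (cs.simple s * w) := by
      intro w hw hzw
      rw [← isPrefix_simple_mul_iff cs (desc hzs) (desc hw)]
      simpa using hzw
    rw [← mem hxs]
    refine ih (x := cs.simple s * x) (y := cs.simple s * y) (z := cs.simple s * z) ?_
      (up hxs hzx) (up hys hzy) ?_ ((mem hzs).2 hv) (by omega)
    · ext w
      rw [mem_coneType_inv_simple_mul_iff cs hxs, mem_coneType_inv_simple_mul_iff cs hys, hxy]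
    -- To show that `sz` is the meet of `sx` and `sy`: a common prefix `u` need not begin with `s`,
    -- but the meet `m` does because `sz ≼ m`. So `s` can be stripped from `m`.
    · obtain ⟨m, hmx, hmy, hm⟩ := exists_meet cs (cs.simple s * x) (cs.simple s * y)
      have hzm := hm _ (up hxs hzx) (up hys hzy)
      have hms : cs.IsLeftDescent m s := hzm.isLeftDescent (desc hzs)
      intro u hux huy
      refine (hm u hux huy).trans ?_
      rw [← isPrefix_simple_mul_iff cs hms (desc hzs), cs.simple_mul_simple_cancel_left]
      refine hz _ ?_ ?_
      · simpa using (isPrefix_simple_mul_iff cs hms (desc hxs)).2 hmx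
      · simpa using (isPrefix_simple_mul_iff cs hms (desc hys)).2 hmy

theorem exists_meet_mem_conePart (cs : CoxeterSystem M W) {T : Set W} {x y : W}
    (hx : x ∈ conePart cs T) (hy : y ∈ conePart cs T) :
    ∃ z ∈ conePart cs T, IsPrefix cs z x ∧ IsPrefix cs z y := by
  obtain ⟨z, hzx, hzy, hz⟩ := exists_meet cs x y
  refine ⟨z, ?_, hzx, hzy⟩
  change coneType cs x⁻¹ = T at hx
  change coneType cs y⁻¹ = T at hy
  change coneType cs z⁻¹ = T
  rw [← hx]
  exact Set.Subset.antisymm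
    (fun v hv => coneType_inv_subset_of_meet cs (hx.trans hy.symm) hzx hzy hz hv)
    hzx.coneType_inv_subset

/-! ### Final roots and boundary roots -/

theorem finalRoots_subset_inversions (cs : CoxeterSystem M W) (w : W) :
    finalRoots cs w ⊆ inversions cs w := by
  rintro _ ⟨s, hs, rfl⟩
  rw [inversions_eq_insert cs hs]
  exact Set.mem_insert _ _

/-- Every inversion of `x` is the unique final root of a prefix of `x`. -/
theorem exists_isPrefix_finalRoots_eq (cs : CoxeterSystem M W) {x : W} {α : B →₀ ℝ}
    (h : α ∈ inversions cs x) :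
    ∃ z, IsPrefix cs z x ∧ finalRoots cs z = {α} := by
  induction hn : cs.length x using Nat.strong_induction_on generalizing x with
  | _ n ih =>
    -- Delete last letters while `α` survives. Once every deletion loses `α`, every final root is
    -- `α`.
    by_cases hex : ∃ s, cs.IsRightDescent x s ∧ α ∈ inversions cs (x * cs.simple s)
    · obtain ⟨s, hs, hα⟩ := hex
      obtain ⟨z, hz, hf⟩ := ih _ (hn ▸ hs) hα rfl
      exact ⟨z, hz.trans (isPrefix_mul_simple cs hs), hf⟩
    · push Not at hex
      have hall : ∀ s, cs.IsRightDescent x s → -geomRep cs x (simpleRoot s) = α := by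
        intro s hs
        rw [inversions_eq_insert cs hs] at h
        exact (h.resolve_right (hex s hs)).symm
      have hx : x ≠ 1 := by
        rintro rfl
        simp [inversions_one] at h
      obtain ⟨s, hs⟩ := cs.exists_rightDescent_of_ne_one hx
      refine ⟨x, .refl cs x, Set.Subset.antisymm ?_ ?_⟩
      · rintro _ ⟨t, ht, rfl⟩
        exact hall t ht
      · rintro _ rfl
        exact ⟨s, hs, (hall s hs).symm⟩

theorem notMem_inversions_of_isPrefix (cs : CoxeterSystem M W) {u z : W} {α : B →₀ ℝ}
    (hf : finalRoots cs z = {α}) (h : IsPrefix cs u z) (hne : u ≠ z) :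
    α ∉ inversions cs u := by
  obtain ⟨s, hs, hu⟩ := h.exists_isPrefix_mul_simple hne
  have : -geomRep cs z (simpleRoot s) = α := by
    have hmem : -geomRep cs z (simpleRoot s) ∈ finalRoots cs z := ⟨s, hs, rfl⟩
    rwa [hf] at hmem
  intro hα
  have := (isPrefix_iff_inversions_subset cs).1 hu hα
  subst α
  exact neg_geomRep_notMem_inversions_mul_simple cs z s this

/-- Intersecting inversion sets `Φ(x)` and `Φ(v)` meet in a single root after replacing `v` by a
suitable prefix. -/
theorem exists_isPrefix_inter_inversions_eq (cs : CoxeterSystem M W) {x v : W}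
    (h : ¬ Disjoint (inversions cs x) (inversions cs v)) :
    ∃ (y : W) (s : B) (β : B →₀ ℝ), IsPrefix cs y v ∧ cs.IsRightDescent y s ∧
      inversions cs x ∩ inversions cs y = {β} ∧
      Disjoint (inversions cs x) (inversions cs (y * cs.simple s)) := by
  induction hn : cs.length v using Nat.strong_induction_on generalizing v with
  | _ n ih =>
    have hv : v ≠ 1 := by
      rintro rfl
      simp [inversions_one] at h
    obtain ⟨s, hs⟩ := cs.exists_rightDescent_of_ne_one hv
    by_cases hd : Disjoint (inversions cs x) (inversions cs (v * cs.simple s))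
    · refine ⟨v, s, -geomRep cs v (simpleRoot s), .refl cs v, hs, ?_, hd⟩
      rw [inversions_eq_insert cs hs] at h ⊢
      rw [Set.disjoint_insert_right, not_and'] at h
      rw [Set.inter_insert_of_mem (not_not.1 (h hd)), hd.inter_eq, insert_empty_eq]
    · obtain ⟨y, t, β, hy, h'⟩ := ih _ (hn ▸ hs) hd rfl
      exact ⟨y, t, β, hy.trans (isPrefix_mul_simple cs hs), h'⟩

/-- The cone type `T(x⁻¹)` consists of the elements without boundary roots among their
inversions. -/
theorem disjoint_inversions_iff_boundaryRoots (cs : CoxeterSystem M W) {x v : W} :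
    v ∈ coneType cs x⁻¹ ↔
      Disjoint (boundaryRoots cs (coneType cs x⁻¹)) (inversions cs v) := by
  constructor
  · intro hv
    rw [Set.disjoint_left]
    rintro β ⟨-, y, w, hw, e⟩ hβ
    change coneType cs w⁻¹ = coneType cs x⁻¹ at hw
    rw [← hw, mem_coneType_inv_iff, Set.disjoint_left] at hv
    have hmem : β ∈ inversions cs w ∩ inversions cs y := by rw [e]; rfl
    exact hv hmem.1 hβ
  · intro hd
    rw [mem_coneType_inv_iff]
    by_contra h
    obtain ⟨y, s, β, hy, -, e, -⟩ := exists_isPrefix_inter_inversions_eq cs h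
    have hmem : β ∈ inversions cs x ∩ inversions cs y := by rw [e]; rfl
    exact Set.disjoint_left.1 hd ⟨hmem.1.1, y, x, rfl, e⟩
      ((isPrefix_iff_inversions_subset cs).1 hy hmem.2)

/-- A boundary root of `T` is witnessed by an element `y` that works for the whole part `Q(T)`. -/
theorem exists_forall_inter_inversions_eq (cs : CoxeterSystem M W) {T : Set W} {β : B →₀ ℝ}
    (hβ : β ∈ boundaryRoots cs T) :
    ∃ y, ∀ x ∈ conePart cs T, inversions cs x ∩ inversions cs y = {β} := by
  obtain ⟨-, y, w, hw, e⟩ := hβ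
  change coneType cs w⁻¹ = T at hw
  have hnd : ¬ Disjoint (inversions cs w) (inversions cs y) := by
    rw [Set.disjoint_iff_inter_eq_empty, e]
    exact Set.singleton_ne_empty β
  obtain ⟨y', s, γ, hy, hs, e', hd⟩ := exists_isPrefix_inter_inversions_eq cs hnd
  have hγ : γ ∈ inversions cs w ∩ inversions cs y' := by rw [e']; rfl
  obtain rfl : γ = β := by
    have : γ ∈ inversions cs w ∩ inversions cs y :=
      ⟨hγ.1, (isPrefix_iff_inversions_subset cs).1 hy hγ.2⟩
    rwa [e] at this
  -- The cone type decides which `Φ(v)` are disjoint from `Φ(x)`. So `Φ(x)` meets `Φ(y')` but not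
  -- `Φ(y's)`, and the only common root is the one lost in between.
  have eq : ∀ x ∈ conePart cs T,
      inversions cs x ∩ inversions cs y' = {-geomRep cs y' (simpleRoot s)} := by
    intro x hx
    change coneType cs x⁻¹ = T at hx
    have mem : ∀ v, Disjoint (inversions cs w) (inversions cs v) ↔
        Disjoint (inversions cs x) (inversions cs v) := by
      intro v
      rw [← mem_coneType_inv_iff, ← mem_coneType_inv_iff, hw, hx]
    have hdx := (mem _).1 hd
    have hnx : ¬ Disjoint (inversions cs x) (inversions cs y') := by
      rw [← mem, Set.disjoint_iff_inter_eq_empty, e']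
      exact Set.singleton_ne_empty γ
    rw [inversions_eq_insert cs hs] at hnx ⊢
    rw [Set.disjoint_insert_right, not_and'] at hnx
    rw [Set.inter_insert_of_mem (not_not.1 (hnx hdx)), hdx.inter_eq, insert_empty_eq]
  refine ⟨y', fun x hx => ?_⟩
  rw [eq x hx, ← eq w hw, e']

theorem boundaryRoots_subset_inversions (cs : CoxeterSystem M W) {T : Set W} {x : W}
    (hx : x ∈ conePart cs T) : boundaryRoots cs T ⊆ inversions cs x := by
  intro β hβ
  obtain ⟨y, hy⟩ := exists_forall_inter_inversions_eq cs hβ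
  have : β ∈ inversions cs x ∩ inversions cs y := by rw [hy x hx]; rfl
  exact this.1

/-! ### Tight gates and joins -/

theorem coneType_inv_eq_of_boundaryRoots_subset (cs : CoxeterSystem M W) {x z : W}
    (hzx : IsPrefix cs z x)
    (h : boundaryRoots cs (coneType cs x⁻¹) ⊆ inversions cs z) :
    coneType cs z⁻¹ = coneType cs x⁻¹ := by
  refine Set.Subset.antisymm (fun v hv => ?_) hzx.coneType_inv_subset
  rw [disjoint_inversions_iff_boundaryRoots]
  exact ((mem_coneType_inv_iff cs).1 hv).mono_left h

/-- The root `α` stays a boundary root at `z`, because `Φ(z) ∩ Φ(y) ⊆ Φ(x) ∩ Φ(y) = {α}`. Every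
member of the part of `z` therefore inverts `α`, while no proper prefix of `z` does; closure under
meets makes `z` minimal. -/
theorem boundaryPrefixes_subset_tightGates (cs : CoxeterSystem M W) (x : W) :
    boundaryPrefixes cs x ⊆ tightGates cs := by
  rintro z ⟨hzx, α, hα, hf⟩
  refine ⟨⟨coneType cs z⁻¹, ⟨z⁻¹, rfl⟩, rfl, fun u hu => ?_⟩, by rw [hf, Set.ncard_singleton]⟩
  have hαz : α ∈ inversions cs z := finalRoots_subset_inversions cs z (by rw [hf]; rfl)
  obtain ⟨m, hm, hmz, hmu⟩ := exists_meet_mem_conePart cs (T := coneType cs z⁻¹) (x := z) rfl hu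
  have hbd : α ∈ boundaryRoots cs (coneType cs z⁻¹) := by
    obtain ⟨y, hy⟩ := exists_forall_inter_inversions_eq cs hα
    have e := hy x rfl
    have hαy : α ∈ inversions cs x ∩ inversions cs y := by rw [e]; rfl
    refine ⟨hαz.1, y, z, rfl, Set.Subset.antisymm ?_ (Set.singleton_subset_iff.2 ⟨hαz, hαy.2⟩)⟩
    rw [← e]
    exact Set.inter_subset_inter_left _ ((isPrefix_iff_inversions_subset cs).1 hzx)
  have hαm := boundaryRoots_subset_inversions cs hm hbd
  by_cases hmz' : m = z
  · exact hmz' ▸ hmu.length_le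
  · exact (notMem_inversions_of_isPrefix cs hf hmz hmz' hαm).elim

/-- A boundary root of `T(x⁻¹)` is an inversion of some element of `∂t(x⁻¹)`. -/
theorem exists_mem_boundaryPrefixes (cs : CoxeterSystem M W) {x : W} {β : B →₀ ℝ}
    (hβ : β ∈ boundaryRoots cs (coneType cs x⁻¹)) :
    ∃ z ∈ boundaryPrefixes cs x, β ∈ inversions cs z := by
  obtain ⟨z, hz, hf⟩ := exists_isPrefix_finalRoots_eq cs
    (boundaryRoots_subset_inversions cs (x := x) rfl hβ)
  exact ⟨z, ⟨hz, β, hβ, hf⟩, finalRoots_subset_inversions cs z (by rw [hf]; rfl)⟩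

/-- The meet of `x` with an upper bound `y` still inverts every boundary root, so it lies in the
part of `x`; minimality of the gate forces it to be `x`. -/
theorem isJoin_boundaryPrefixes (cs : CoxeterSystem M W) {x : W} (hx : x ∈ gates cs) :
    IsJoin cs (boundaryPrefixes cs x) x := by
  obtain ⟨T, -, hT, hmin⟩ := hx
  obtain rfl : coneType cs x⁻¹ = T := hT
  refine ⟨fun z hz => hz.1, fun y hy => ?_⟩
  obtain ⟨m, hmx, hmy, hm⟩ := exists_meet cs x y
  have hmT : coneType cs m⁻¹ = coneType cs x⁻¹ := by
    refine coneType_inv_eq_of_boundaryRoots_subset cs hmx fun β hβ => ?_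
    obtain ⟨z, hz, hβz⟩ := exists_mem_boundaryPrefixes cs hβ
    exact (isPrefix_iff_inversions_subset cs).1 (hm z hz.1 (hy z hz)) hβz
  rwa [hmx.eq_of_length_le (hmin m hmT)] at hmy

theorem coneType_inv_eq_iInter (cs : CoxeterSystem M W) (x : W) :
    coneType cs x⁻¹ = ⋂ z ∈ boundaryPrefixes cs x, coneType cs z⁻¹ := by
  refine Set.Subset.antisymm
    (Set.subset_iInter₂ fun z hz => hz.1.coneType_inv_subset) fun v hv => ?_
  rw [disjoint_inversions_iff_boundaryRoots, Set.disjoint_left]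
  intro β hβ hβv
  obtain ⟨z, hz, hβz⟩ := exists_mem_boundaryPrefixes cs hβ
  have hvz := (mem_coneType_inv_iff cs).1 (Set.mem_iInter₂.1 hv z hz)
  exact Set.disjoint_left.1 hvz hβz hβv

theorem exists_coneType_eq_iInter (cs : CoxeterSystem M W) {T : Set W} (hT : T ∈ coneTypes cs) :
    ∃ A ⊆ tightGates cs, T = ⋂ z ∈ A, coneType cs z⁻¹ := by
  obtain ⟨w, rfl⟩ := hT
  refine ⟨_, boundaryPrefixes_subset_tightGates cs w⁻¹, ?_⟩
  rw [← coneType_inv_eq_iInter, inv_inv]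

/-! ### The partition defined by tight gates -/

theorem tightSetoid_iff (cs : CoxeterSystem M W) {x y : W} :
    tightSetoid cs x y ↔ coneType cs x⁻¹ = coneType cs y⁻¹ := by
  constructor
  · intro h
    ext w
    obtain ⟨A, hA, e⟩ := exists_coneType_eq_iInter cs ⟨w⁻¹, rfl⟩
    -- By symmetry `w ∈ T(x⁻¹)` becomes `x ∈ T(w⁻¹)`, an intersection of cone types of tight gates.
    rw [mem_coneType_inv_comm, mem_coneType_inv_comm (x := y), e]
    simp only [Set.mem_iInter]
    exact forall₂_congr fun z hz => h z (hA hz)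
  · intro h w _
    rw [mem_coneType_inv_comm, h, mem_coneType_inv_comm]

theorem classes_tightSetoid (cs : CoxeterSystem M W) :
    (tightSetoid cs).classes = conePartition cs := by
  have e : ∀ y, {x | tightSetoid cs x y} = conePart cs (coneType cs y⁻¹) := fun y =>
    Set.ext fun x => tightSetoid_iff cs
  ext P
  constructor
  · rintro ⟨y, rfl⟩
    exact ⟨_, ⟨y⁻¹, rfl⟩, (e y).symm⟩
  · rintro ⟨_, ⟨w, rfl⟩, rfl⟩
    exact ⟨w⁻¹, by rw [e, inv_inv]⟩

theorem isRegularPartition_classes_tightSetoid (cs : CoxeterSystem M W) :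
    IsRegularPartition cs (tightSetoid cs).classes := by
  refine ⟨Setoid.isPartition_classes _, ?_, ?_⟩
  · rintro _ ⟨w, rfl⟩ x hx y hy s
    have hxy : coneType cs x⁻¹ = coneType cs y⁻¹ :=
      ((tightSetoid_iff cs).1 hx).trans ((tightSetoid_iff cs).1 hy).symm
    rw [← not_iff_not, ← simple_mem_coneType_inv_iff, ← simple_mem_coneType_inv_iff, hxy]
  · rintro _ ⟨w, rfl⟩ s hs
    refine ⟨_, ⟨cs.simple s * w, rfl⟩, fun x hx => (tightSetoid_iff cs).2 ?_⟩
    ext v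
    rw [mem_coneType_inv_simple_mul_iff cs (hs x hx),
      mem_coneType_inv_simple_mul_iff cs (hs w ((tightSetoid cs).refl w)),
      (tightSetoid_iff cs).1 hx]

end ConeType

theorem theorem5p2 {B : Type*} [Finite B] {M : CoxeterMatrix B} {W : Type*} [Group W]
    (cs : CoxeterSystem M W) :
    (∀ x ∈ ConeType.gates cs,
      ConeType.boundaryPrefixes cs x ⊆ ConeType.tightGates cs ∧
      ConeType.IsJoin cs (ConeType.boundaryPrefixes cs x) x) ∧
    (∀ T ∈ ConeType.coneTypes cs, ∃ A ⊆ ConeType.tightGates cs,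
      T = ⋂ z ∈ A, ConeType.coneType cs z⁻¹) ∧
    (ConeType.tightSetoid cs).classes = ConeType.conePartition cs ∧
    ConeType.IsRegularPartition cs (ConeType.tightSetoid cs).classes := by
  exact ⟨fun x hx => ⟨ConeType.boundaryPrefixes_subset_tightGates cs x,
    ConeType.isJoin_boundaryPrefixes cs hx⟩, fun _ hT => ConeType.exists_coneType_eq_iInter cs hT,
    ConeType.classes_tightSetoid cs, ConeType.isRegularPartition_classes_tightSetoid cs⟩
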